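/- A real $n\times n$ matrix $S=[s_{ij}]$ with nonnegative entries is called *infinitely divisible* if for every real $r>0$ the entrywise power $S^{\circ r}=[s_{ij}^r]$ is positive semidefinite (that is, symmetric with $\langle x,S^{\circ r}x\rangle\ge 0$ for all $x\in\mathbb{R}^n$). A real matrix is called *totally positive* if all its minors (determinants of square submatrices, with rows and columns taken in increasing order) are nonnegative, and *strictly totally positive* if all its minors are positive. **Theorem.** (1) Let $p_1<p_2<\cdots<p_n$ be positive real numbers. Then the matrix $B=\left[(p_i+p_j)^{p_i+p_j}\right]_{i,j=1}^n$ is infinitely divisible, nonsingular and totally positive. (2) For every positive integer $n$, the Hankel matrix $A=\left[(i+j-1)^{i+j-1}\right]_{i,j=1}^n$ is strictly totally positive, and so is its entrywise power $A^{\circ r}=\left[(i+j-1)^{(i+j-1)r}\right]_{i,j=1}^n$ for every real $r>0$. -/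

import Mathlib

noncomputable section

/-- The Hadamard (entrywise) power of a real matrix, with real exponent `r`. -/
def hadamardPower {m n : ℕ} (M : Matrix (Fin m) (Fin n) ℝ) (r : ℝ) : Matrix (Fin m) (Fin n) ℝ :=
  Matrix.of fun i j => M i j ^ r

/-- A matrix with nonnegative entries is infinitely divisible if all its entrywise powers with
positive real exponent are positive semidefinite (in particular symmetric). -/
def IsInfinitelyDivisible {n : ℕ} (M : Matrix (Fin n) (Fin n) ℝ) : Prop :=
  (∀ i j, 0 ≤ M i j) ∧ ∀ r : ℝ, 0 < r → (hadamardPower M r).PosSemidef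

/-- All minors are nonnegative: a minor is the determinant of a square submatrix given by rows
`f 0 < f 1 < ...` and columns `g 0 < g 1 < ...`. The minors of order one are the entries. -/
def IsTotallyPositive {m n : ℕ} (M : Matrix (Fin m) (Fin n) ℝ) : Prop :=
  ∀ (k : ℕ) (f : Fin k → Fin m) (g : Fin k → Fin n),
    StrictMono f → StrictMono g → 0 ≤ (M.submatrix f g).det

/-- All minors are positive. -/
def IsStrictlyTotallyPositive {m n : ℕ} (M : Matrix (Fin m) (Fin n) ℝ) : Prop :=
  ∀ (k : ℕ) (f : Fin k → Fin m) (g : Fin k → Fin n),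
    StrictMono f → StrictMono g → 0 < (M.submatrix f g).det

/-- The matrix with entries `(p i + p j) ^ (p i + p j)`. -/
def matrixB {n : ℕ} (p : Fin n → ℝ) : Matrix (Fin n) (Fin n) ℝ :=
  Matrix.of fun i j => (p i + p j) ^ (p i + p j)

/-- The Hankel matrix with entries `(i + j - 1) ^ (i + j - 1)` for `1 ≤ i, j ≤ n`; with indices
counted from zero the entry is `(i + j + 1) ^ (i + j + 1)`. -/
def matrixA (n : ℕ) : Matrix (Fin n) (Fin n) ℝ :=
  Matrix.of fun i j => (((i : ℕ) + (j : ℕ) + 1 : ℕ) : ℝ) ^ ((i : ℕ) + (j : ℕ) + 1)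

end

/-! Write `s ^ (r s)` as `exp (r s log s)`. On vectors with coordinate sum zero, the quadratic form
of `(x + y) log (x + y)` is a limit of integrals of Cauchy forms, hence nonnegative
(`mul_log_quadratic_nonneg`); Schoenberg's theorem makes the exponential positive semidefinite for
every `r > 0`. A null vector for distinct nodes would give a linear relation between translates of
`s ^ (r s)`, which the fastest-growing translate excludes, so the matrix is positive definite.

A minor of the Hankel matrix with consecutive rows and columns is again such a matrix, so it is
positive, and Fekete's criterion extends this to all minors. Minors of `B` are limits of Hankel
minors on lattices of mesh `1 / N`, hence nonnegative. -/

open Filter Topology Matrix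

/-! ### Conditional positivity of `(x + y) log (x + y)` -/

/-- The Cauchy kernel `1 / (x + y)` is positive semidefinite on the positive half-line. -/
theorem cauchy_quadratic_nonneg {ι : Type*} [Fintype ι] (p : ι → ℝ) (hp : ∀ i, 0 < p i)
    (c : ι → ℝ) : 0 ≤ ∑ i, ∑ j, c i * c j * (1 / (p i + p j)) := by
  -- `G u` is the integral over `t ≥ u` of `(∑ i, c i * exp (-p i * t)) ^ 2`, and `G 0` is the form
  -- in question.
  set G : ℝ → ℝ := fun u => ∑ i, ∑ j, c i * c j * (Real.exp (-(p i + p j) * u) / (p i + p j))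
    with hG
  have hne : ∀ i j, p i + p j ≠ 0 := fun i j => (add_pos (hp i) (hp j)).ne'
  have hder : ∀ u, HasDerivAt G (-(∑ i, c i * Real.exp (-p i * u)) ^ 2) u := by
    intro u
    have h : HasDerivAt G
        (∑ i, ∑ j, c i * c j * (Real.exp (-(p i + p j) * u) * (-(p i + p j)) / (p i + p j))) u := by
      refine HasDerivAt.fun_sum fun i _ => HasDerivAt.fun_sum fun j _ => ?_
      refine HasDerivAt.const_mul _ (HasDerivAt.div_const ?_ _)
      simpa using ((hasDerivAt_id u).const_mul (-(p i + p j))).exp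
    convert h using 1
    rw [sq, Finset.sum_mul_sum, ← Finset.sum_neg_distrib]
    refine Finset.sum_congr rfl fun i _ => ?_
    rw [← Finset.sum_neg_distrib]
    refine Finset.sum_congr rfl fun j _ => ?_
    have : Real.exp (-(p i + p j) * u) = Real.exp (-p i * u) * Real.exp (-p j * u) := by
      rw [← Real.exp_add]; ring_nf
    rw [this]
    field_simp [hne i j]
  have hanti : Antitone G := antitone_of_hasDerivAt_nonpos hder
    fun u => neg_nonpos.2 (sq_nonneg _)
  have hlim : Tendsto G atTop (𝓝 0) := by
    have : Tendsto G atTop (𝓝 (∑ i, ∑ j, c i * c j * (0 / (p i + p j)))) := by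
      refine tendsto_finsetSum _ fun i _ => tendsto_finsetSum _ fun j _ => ?_
      refine Tendsto.const_mul _ (Tendsto.div_const ?_ _)
      refine Real.tendsto_exp_atBot.comp ?_
      exact tendsto_id.const_mul_atTop_of_neg (neg_neg_of_pos (add_pos (hp i) (hp j)))
    simpa using this
  have := hanti.le_of_tendsto hlim 0
  simpa [hG] using this

/-- The kernel `(x + y) log (x + y)` is conditionally positive semidefinite. -/
theorem mul_log_quadratic_nonneg {ι : Type*} [Fintype ι] (p : ι → ℝ) (hp : ∀ i, 0 < p i)
    (c : ι → ℝ) (hc : ∑ i, c i = 0) :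
    0 ≤ ∑ i, ∑ j, c i * c j * ((p i + p j) * Real.log (p i + p j)) := by
  have hpos : ∀ i j, 0 < p i + p j := fun i j => add_pos (hp i) (hp j)
  -- With `s = p i + p j`, the bracket is the integral of `t / (s + t)` over `[0, T]`, so `H'` is
  -- `T` times a Cauchy form with nodes `p i + T / 2`.
  set H : ℝ → ℝ := fun T => ∑ i, ∑ j, c i * c j *
    (T - (p i + p j) * Real.log (p i + p j + T) + (p i + p j) * Real.log (p i + p j)) with hH
  have hder : ∀ T, 0 ≤ T →
      HasDerivAt H (T * ∑ i, ∑ j, c i * c j * (1 / (p i + T / 2 + (p j + T / 2)))) T := by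
    intro T hT
    have h : HasDerivAt H
        (∑ i, ∑ j, c i * c j * (1 - (p i + p j) * (1 / (p i + p j + T)))) T := by
      refine HasDerivAt.fun_sum fun i _ => HasDerivAt.fun_sum fun j _ => ?_
      refine HasDerivAt.const_mul _ (HasDerivAt.add_const _ ((hasDerivAt_id T).sub
        (HasDerivAt.const_mul _ ?_)))
      exact ((hasDerivAt_id T).const_add (p i + p j)).log (by have := hpos i j; simp; linarith)
    convert h using 1
    rw [Finset.mul_sum]
    refine Finset.sum_congr rfl fun i _ => ?_
    rw [Finset.mul_sum]
    refine Finset.sum_congr rfl fun j _ => ?_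
    have h1 : p i + p j + T ≠ 0 := by have := hpos i j; linarith
    have h2 : p i + T / 2 + (p j + T / 2) = p i + p j + T := by ring
    rw [h2]
    field_simp
    ring
  have hmono : MonotoneOn H (Set.Ici 0) := by
    refine monotoneOn_of_hasDerivWithinAt_nonneg (convex_Ici 0)
      (fun T hT => (hder T hT).continuousAt.continuousWithinAt)
      (fun T hT => (hder T (interior_subset hT)).hasDerivWithinAt) fun T hT => ?_
    have hT : (0 : ℝ) ≤ T := interior_subset hT
    exact mul_nonneg hT (cauchy_quadratic_nonneg _ (fun i => by have := hp i; linarith) c)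
  have hH0 : H 0 = 0 := by simp [hH]
  have hHnn : ∀ T, 0 ≤ T → 0 ≤ H T := fun T hT => by
    rw [← hH0]; exact hmono (Set.mem_Ici.2 le_rfl) hT hT
  have hcc : ∀ a : ℝ, ∑ i, ∑ j, c i * c j * a = 0 := fun a => by
    simp [← Finset.sum_mul, ← Finset.mul_sum, hc]
  have hcs : ∑ i, ∑ j, c i * c j * (p i + p j) = 0 := by
    have h1 : ∑ i, ∑ j, c i * c j * (p i + p j)
        = ∑ i, ∑ j, (c i * p i * c j + c i * (c j * p j)) :=
      Finset.sum_congr rfl fun i _ => Finset.sum_congr rfl fun j _ => by ring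
    rw [h1]
    simp_rw [Finset.sum_add_distrib, ← Finset.mul_sum, hc, ← Finset.sum_mul, hc]
    simp
  -- Splitting `log (s + T) = log T + log (1 + s / T)` leaves terms in `T` and `s log T`, which
  -- vanish because `∑ i, c i = 0`; `R` is the remainder and tends to `0`.
  set R : ℝ → ℝ := fun T => ∑ i, ∑ j, c i * c j *
    ((p i + p j) * Real.log (1 + (p i + p j) / T)) with hR
  have hQ : ∀ T, 0 < T → ∑ i, ∑ j, c i * c j * ((p i + p j) * Real.log (p i + p j))
      = H T + R T := by
    intro T hT
    have h0 : ∑ i, ∑ j, c i * c j * ((p i + p j) * Real.log (p i + p j))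
        = H T + R T - ∑ i, ∑ j, c i * c j * T
          + (∑ i, ∑ j, c i * c j * (p i + p j)) * Real.log T := by
      rw [hH, hR, Finset.sum_mul, ← Finset.sum_add_distrib, ← Finset.sum_sub_distrib,
        ← Finset.sum_add_distrib]
      refine Finset.sum_congr rfl fun i _ => ?_
      rw [Finset.sum_mul, ← Finset.sum_add_distrib, ← Finset.sum_sub_distrib,
        ← Finset.sum_add_distrib]
      refine Finset.sum_congr rfl fun j _ => ?_
      have h1 : 1 + (p i + p j) / T = (p i + p j + T) / T := by field_simp; ring
      rw [h1, Real.log_div (by have := hpos i j; linarith) hT.ne']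
      ring
    rw [h0, hcc, hcs]; ring
  have hRlim : Tendsto R atTop (𝓝 0) := by
    have : Tendsto R atTop
        (𝓝 (∑ i, ∑ j, c i * c j * ((p i + p j) * Real.log (1 + 0)))) := by
      refine tendsto_finsetSum _ fun i _ => tendsto_finsetSum _ fun j _ => ?_
      refine Tendsto.const_mul _ (Tendsto.const_mul _ (Tendsto.log ?_ (by norm_num)))
      exact tendsto_const_nhds.add (tendsto_const_nhds.div_atTop tendsto_id)
    simpa using this
  refine le_of_tendsto hRlim ?_
  filter_upwards [eventually_gt_atTop 0] with T hT
  rw [hQ T hT]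
  exact le_add_of_nonneg_left (hHnn T hT.le)

/-! ### Entrywise exponentials and Schoenberg's theorem -/

theorem posSemidef_of_quadratic_nonneg {ι : Type*} [Fintype ι] {M : Matrix ι ι ℝ}
    (hs : ∀ i j, M i j = M j i) (hq : ∀ c : ι → ℝ, 0 ≤ ∑ i, ∑ j, c i * c j * M i j) :
    M.PosSemidef := by
  refine PosSemidef.of_dotProduct_mulVec_nonneg (by ext i j; simp [hs i j]) fun c => ?_
  refine (hq c).trans_eq ?_
  simp only [dotProduct, mulVec, Finset.mul_sum, Pi.star_apply, star_trivial, mul_assoc]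
  exact Finset.sum_congr rfl fun i _ => Finset.sum_congr rfl fun j _ => by ring

theorem Matrix.PosSemidef.quadratic_nonneg {ι : Type*} [Fintype ι] {M : Matrix ι ι ℝ}
    (hM : M.PosSemidef) (c : ι → ℝ) : 0 ≤ ∑ i, ∑ j, c i * c j * M i j := by
  refine (hM.dotProduct_mulVec_nonneg c).trans_eq ?_
  simp only [dotProduct, mulVec, Finset.mul_sum, Pi.star_apply, star_trivial]
  exact Finset.sum_congr rfl fun i _ => Finset.sum_congr rfl fun j _ => by ring

/-- Entrywise natural powers of a positive semidefinite matrix are positive semidefinite. -/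
theorem Matrix.PosSemidef.entrywise_pow {ι : Type*} [Fintype ι] {M : Matrix ι ι ℝ}
    (hM : M.PosSemidef) (m : ℕ) : (of fun i j => M i j ^ m).PosSemidef := by
  induction m with
  | zero =>
    refine posSemidef_of_quadratic_nonneg (by simp) fun c => ?_
    simp only [of_apply, pow_zero, mul_one, ← Finset.sum_mul_sum]
    exact mul_self_nonneg _
  | succ m ih =>
    have h : (of fun i j => M i j ^ (m + 1)) = (of fun i j => M i j ^ m) ⊙ M := by
      ext i j; simp [pow_succ]
    rw [h]
    exact ih.hadamard hM

/-- The entrywise exponential of a positive semidefinite matrix is positive semidefinite. -/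
theorem Matrix.PosSemidef.entrywise_exp {ι : Type*} [Fintype ι] {M : Matrix ι ι ℝ}
    (hM : M.PosSemidef) : (of fun i j => Real.exp (M i j)).PosSemidef := by
  refine posSemidef_of_quadratic_nonneg
    (fun i j => by simp [show M i j = M j i by simpa using hM.1.apply j i]) fun c => ?_
  have hsum : HasSum (fun m : ℕ => ∑ i, ∑ j, c i * c j * (M i j ^ m / m.factorial))
      (∑ i, ∑ j, c i * c j * Real.exp (M i j)) := by
    refine hasSum_sum fun i _ => hasSum_sum fun j _ => HasSum.mul_left _ ?_
    rw [Real.exp_eq_exp_ℝ]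
    exact NormedSpace.expSeries_div_hasSum_exp (M i j)
  refine hsum.nonneg fun m => ?_
  have h := (hM.entrywise_pow m).quadratic_nonneg c
  have h2 : ∑ i, ∑ j, c i * c j * (M i j ^ m / m.factorial)
      = (∑ i, ∑ j, c i * c j * M i j ^ m) / m.factorial := by
    simp_rw [Finset.sum_div, mul_div_assoc]
  rw [h2]
  exact div_nonneg h (by positivity)

/-- Schoenberg: the entrywise exponential of a conditionally positive semidefinite matrix is
positive semidefinite. -/
theorem posSemidef_exp_of_conditionally {ι : Type*} [Fintype ι] {M : Matrix ι ι ℝ}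
    (hs : ∀ i j, M i j = M j i)
    (hq : ∀ c : ι → ℝ, ∑ i, c i = 0 → 0 ≤ ∑ i, ∑ j, c i * c j * M i j) :
    (of fun i j => Real.exp (M i j)).PosSemidef := by
  classical
  rcases isEmpty_or_nonempty ι with he | ⟨⟨z⟩⟩
  · exact posSemidef_of_quadratic_nonneg (fun i => he.elim i) (by simp)
  -- Centring at `z`: this form at `c` equals the form of `M` at `c` minus `∑ k, c k` placed at `z`,
  -- a vector with sum zero.
  have hK : (of fun i j => M i j - M i z - M z j + M z z).PosSemidef := by
    refine posSemidef_of_quadratic_nonneg (fun i j => ?_) fun c => ?_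
    · simp only [of_apply]; rw [hs i j, hs i z, hs z j]; ring
    · have aux : ∀ v : ι → ℝ, ∑ i, (c i - if i = z then ∑ k, c k else 0) * v i
          = ∑ i, c i * (v i - v z) := fun v => by
        simp [sub_mul, mul_sub, Finset.sum_sub_distrib, Finset.sum_mul]
      refine (hq (fun i => c i - if i = z then ∑ k, c k else 0) (by simp)).trans_eq ?_
      simp_rw [mul_assoc, ← Finset.mul_sum]
      rw [aux, aux]
      refine Finset.sum_congr rfl fun i _ => ?_
      rw [aux, ← Finset.sum_sub_distrib]
      congr 1
      exact Finset.sum_congr rfl fun j _ => by simp only [of_apply]; ring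
  refine posSemidef_of_quadratic_nonneg (fun i j => by simp [hs i j]) fun c => ?_
  -- The exponential of `M` is that of the centred matrix with row `i` and column `i` rescaled by
  -- `exp (M i z - M z z / 2)`.
  convert hK.entrywise_exp.quadratic_nonneg
    (fun i => c i * Real.exp (M i z - M z z / 2)) using 1
  refine Finset.sum_congr rfl fun i _ => Finset.sum_congr rfl fun j _ => ?_
  simp only [of_apply]
  have : Real.exp (M i j) = Real.exp (M i z - M z z / 2) * Real.exp (M j z - M z z / 2)
      * Real.exp (M i j - M i z - M z j + M z z) := by
    rw [← Real.exp_add, ← Real.exp_add, hs j z]; ring_nf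
  rw [this]; ring

/-! ### Positive definiteness for distinct nodes -/

/-- The matrix `(p i + p j) ^ (r (p i + p j))` is positive semidefinite. -/
theorem posSemidef_exp_mul_log {ι : Type*} [Fintype ι] (p : ι → ℝ) (hp : ∀ i, 0 < p i)
    {r : ℝ} (hr : 0 < r) :
    (of fun i j => Real.exp (r * ((p i + p j) * Real.log (p i + p j)))).PosSemidef := by
  refine posSemidef_exp_of_conditionally
    (M := of fun i j => r * ((p i + p j) * Real.log (p i + p j)))
    (fun i j => by simp [add_comm (p i)]) fun c hc => ?_
  have := mul_nonneg hr.le (mul_log_quadratic_nonneg p hp c hc)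
  refine this.trans_eq ?_
  rw [Finset.mul_sum]
  refine Finset.sum_congr rfl fun i _ => ?_
  rw [Finset.mul_sum]
  exact Finset.sum_congr rfl fun j _ => by simp only [of_apply]; ring

/-- The difference of exponents is eventually at most `r (a - b) log (a + y)`, by monotonicity of
the logarithm. -/
theorem tendsto_exp_mul_log_ratio {a b r : ℝ} (hab : a < b) (hr : 0 < r) :
    Tendsto (fun y : ℝ => Real.exp (r * ((a + y) * Real.log (a + y)))
      / Real.exp (r * ((b + y) * Real.log (b + y)))) atTop (𝓝 0) := by
  simp_rw [← Real.exp_sub]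
  refine Real.tendsto_exp_atBot.comp ?_
  have h : Tendsto (fun y => r * (a - b) * Real.log (a + y)) atTop atBot :=
    (Real.tendsto_log_atTop.comp (tendsto_atTop_add_const_left _ a tendsto_id)).const_mul_atTop_of_neg
      (mul_neg_of_pos_of_neg hr (by linarith))
  refine tendsto_atBot_mono' _ ?_ h
  filter_upwards [eventually_ge_atTop (1 - a)] with y hy
  have h1 : Real.log (a + y) ≤ Real.log (b + y) := Real.log_le_log (by linarith) (by linarith)
  have h2 : (b + y) * Real.log (a + y) ≤ (b + y) * Real.log (b + y) :=
    mul_le_mul_of_nonneg_left h1 (by linarith)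
  nlinarith [mul_le_mul_of_nonneg_left h2 hr.le]

/-- The translates of `s ^ (r s)` by distinct amounts are linearly independent. -/
theorem eq_zero_of_sum_translates_eq_zero {ι : Type*} [Fintype ι] (p : ι → ℝ)
    (hinj : Function.Injective p) {r : ℝ} (hr : 0 < r) (c : ι → ℝ)
    (h : ∀ y > 0, ∑ i, c i * Real.exp (r * ((p i + y) * Real.log (p i + y))) = 0) : c = 0 := by
  classical
  by_contra hc
  obtain ⟨k, hk⟩ := Function.ne_iff.1 hc
  -- The largest node with nonzero coefficient dominates: after division by its translate, only `c
  -- m` survives as `y → ∞`.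
  obtain ⟨m, hm, hmax⟩ := Finset.exists_max_image (Finset.univ.filter fun i => c i ≠ 0) p
    ⟨k, by simpa using hk⟩
  have hm0 : c m ≠ 0 := by simpa using hm
  have hlim : Tendsto (fun y : ℝ => ∑ i, c i * (Real.exp (r * ((p i + y) * Real.log (p i + y)))
      / Real.exp (r * ((p m + y) * Real.log (p m + y))))) atTop
      (𝓝 (∑ i, if i = m then c m else 0)) := by
    refine tendsto_finsetSum _ fun i _ => ?_
    by_cases him : i = m
    · subst him
      simp
    · rw [if_neg him]
      by_cases hi : c i = 0
      · simp [hi]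
      · have hlt : p i < p m :=
          lt_of_le_of_ne (hmax i (by simpa using hi)) (fun e => him (hinj e))
        simpa using (tendsto_exp_mul_log_ratio hlt hr).const_mul (c i)
  have hzero : Tendsto (fun y : ℝ => ∑ i, c i * (Real.exp (r * ((p i + y) * Real.log (p i + y)))
      / Real.exp (r * ((p m + y) * Real.log (p m + y))))) atTop (𝓝 0) := by
    refine tendsto_const_nhds.congr' ?_
    filter_upwards [eventually_gt_atTop 0] with y hy
    simp_rw [← mul_div_assoc]
    rw [← Finset.sum_div, h y hy, zero_div]
  have := tendsto_nhds_unique hlim hzero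
  simp at this
  exact hm0 this

/-- The matrix `(p i + p j) ^ (r (p i + p j))` is positive definite for distinct `p i`. -/
theorem posDef_exp_mul_log {ι : Type*} [Fintype ι] (p : ι → ℝ) (hp : ∀ i, 0 < p i)
    (hinj : Function.Injective p) {r : ℝ} (hr : 0 < r) :
    (of fun i j => Real.exp (r * ((p i + p j) * Real.log (p i + p j)))).PosDef := by
  classical
  have hS := posSemidef_exp_mul_log p hp hr
  rw [hS.posDef_iff_isUnit, ← Matrix.mulVec_injective_iff_isUnit]
  rw [← Matrix.coe_mulVecLin, ← LinearMap.ker_eq_bot, LinearMap.ker_eq_bot']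
  intro c hc
  rw [Matrix.mulVecLin_apply] at hc
  refine eq_zero_of_sum_translates_eq_zero p hinj hr c fun y hy => ?_
  -- Adjoin `y` as an extra node. The null vector extended by zero has form zero for the larger
  -- semidefinite matrix, hence lies in its kernel; the row of `y` is the wanted relation.
  have hq : ∀ j, Option.elim j y p > 0 := by rintro (_ | j) <;> simp [hy, hp]
  have hT := posSemidef_exp_mul_log (fun j : Option ι => j.elim y p) hq hr
  have h0 := (hT.dotProduct_mulVec_zero_iff (fun j => j.elim 0 c)).1 (by
    have h1 : ∀ i, ∑ j, Real.exp (r * ((p i + p j) * Real.log (p i + p j))) * c j = 0 :=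
      fun i => congrFun hc i
    simp [dotProduct, mulVec, Fintype.sum_option, h1])
  have h1 := congrFun h0 none
  simp only [mulVec, dotProduct, of_apply, Fintype.sum_option, Option.elim, mul_zero,
    zero_add, Pi.zero_apply] at h1
  rw [← h1]
  exact Finset.sum_congr rfl fun i _ => by rw [add_comm y, mul_comm]

/-! ### Fekete's criterion -/

/-- Reduction of a determinant with nonzero first column by dividing the rows by their first entry
and taking differences of consecutive rows. -/
theorem det_eq_prod_mul_det_differences {p : ℕ} (M : Matrix (Fin (p + 1)) (Fin (p + 1)) ℝ)
    (h : ∀ i, M i 0 ≠ 0) :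
    M.det = (∏ i, M i 0) * (of fun i j : Fin p =>
      M i.succ j.succ / M i.succ 0 - M i.castSucc j.succ / M i.castSucc 0).det := by
  have h1 : M = of fun i j => M i 0 * (of fun i j => M i j / M i 0 :
      Matrix (Fin (p + 1)) (Fin (p + 1)) ℝ) i j := by
    ext i j; simp only [of_apply]; field_simp [h i]
  conv_lhs => rw [h1]
  rw [det_mul_column]
  congr 1
  have h2 : (of fun i j => M i j / M i 0 : Matrix (Fin (p + 1)) (Fin (p + 1)) ℝ).det
      = (of (Fin.cons (fun j => M 0 j / M 0 0)
          (fun (i : Fin p) j => M i.succ j / M i.succ 0 - M i.castSucc j / M i.castSucc 0)) :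
        Matrix (Fin (p + 1)) (Fin (p + 1)) ℝ).det := by
    refine det_eq_of_forall_row_eq_smul_add_pred (fun _ => 1) (fun j => by simp) fun i j => by simp
  rw [h2, det_succ_column_zero, Fin.sum_univ_succ]
  have h3 : ∀ i : Fin p, M i.succ 0 / M i.succ 0 - M i.castSucc 0 / M i.castSucc 0 = 0 := by
    intro i; rw [div_self (h _), div_self (h _), sub_self]
  simp only [of_apply, Fin.cons_zero, Fin.cons_succ, h3, div_self (h 0)]
  simp [submatrix]

/-- If for each `p ≤ k` all minors of consecutive rows and the first `p` columns are positive, then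
so are all minors with the first `k` columns. -/
theorem det_pos_of_consecutive_rows (k : ℕ) (V : ℕ → ℕ → ℝ)
    (hV : ∀ p ≤ k, ∀ a, 0 < (of fun i j : Fin p => V (a + i) j).det)
    (f : Fin k → ℕ) (hf : StrictMono f) : 0 < (of fun i j : Fin k => V (f i) j).det := by
  induction k generalizing V with
  | zero => simp
  | succ k ih =>
    have h0 : ∀ a, 0 < V a 0 := fun a => by simpa using hV 1 (by omega) a
    set W : ℕ → ℕ → ℝ := fun a j => V (a + 1) (j + 1) / V (a + 1) 0 - V a (j + 1) / V a 0 with hW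
    -- The row reduction turns a consecutive-row minor of `V` of order `p + 1` into one of `W` of
    -- order `p`, up to a positive factor.
    have hWpos : ∀ p ≤ k, ∀ a, 0 < (of fun i j : Fin p => W (a + i) j).det := by
      intro p hp a
      have h := hV (p + 1) (by omega) a
      rw [det_eq_prod_mul_det_differences _ (fun i => by simpa using (h0 _).ne')] at h
      have h2 := pos_of_mul_pos_right h (Finset.prod_nonneg fun i _ => by simpa using (h0 _).le)
      simpa [hW, add_assoc] using h2
    rw [det_eq_prod_mul_det_differences _ (fun i => by simpa using (h0 _).ne')]
    refine mul_pos (Finset.prod_pos fun i _ => by simpa using h0 _) ?_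
    -- Differences between rows `f i` and `f (i + 1)` telescope into rows of `W`. Expanding by
    -- multilinearity picks one row from each successive interval, so the chosen rows increase and
    -- induction applies.
    have hrow : (of fun i j : Fin k =>
        (of fun i j : Fin (k + 1) => V (f i) j) i.succ j.succ
          / (of fun i j : Fin (k + 1) => V (f i) j) i.succ 0
        - (of fun i j : Fin (k + 1) => V (f i) j) i.castSucc j.succ
          / (of fun i j : Fin (k + 1) => V (f i) j) i.castSucc 0)
        = fun i : Fin k => ∑ m ∈ Finset.Ico (f i.castSucc) (f i.succ), fun j : Fin k => W m j := by
      ext i j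
      rw [Finset.sum_apply]
      simp only [of_apply, hW, Fin.val_succ, Fin.val_zero]
      exact (Finset.sum_Ico_sub (fun m => V m (j + 1) / V m 0)
        (hf.monotone i.castSucc_lt_succ.le)).symm
    have hdet : (of fun i j : Fin k =>
        (of fun i j : Fin (k + 1) => V (f i) j) i.succ j.succ
          / (of fun i j : Fin (k + 1) => V (f i) j) i.succ 0
        - (of fun i j : Fin (k + 1) => V (f i) j) i.castSucc j.succ
          / (of fun i j : Fin (k + 1) => V (f i) j) i.castSucc 0).det
        = ∑ g ∈ Fintype.piFinset fun i : Fin k => Finset.Ico (f i.castSucc) (f i.succ),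
          (of fun i j : Fin k => W (g i) j).det := by
      rw [hrow]
      exact (detRowAlternating (n := Fin k) (R := ℝ)).toMultilinearMap.map_sum_finset
        (fun (i : Fin k) (m : ℕ) (j : Fin k) => W m j)
        (fun i : Fin k => Finset.Ico (f i.castSucc) (f i.succ))
    rw [hdet]
    refine Finset.sum_pos (fun g hg => ih W hWpos g ?_) ?_
    · have hg' : ∀ i : Fin k, f i.castSucc ≤ g i ∧ g i < f i.succ := fun i => by
        simpa using Fintype.mem_piFinset.1 hg i
      intro i j hij
      exact ((hg' i).2.trans_le (hf.monotone (Fin.succ_le_castSucc_iff.2 hij))).trans_le (hg' j).1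
    · exact Fintype.piFinset_nonempty.2 fun i => by simpa using hf i.castSucc_lt_succ

/-- Fekete's criterion: if all minors of consecutive rows and consecutive columns are positive,
then all minors are positive. -/
theorem det_pos_of_consecutive (V : ℕ → ℕ → ℝ)
    (hV : ∀ p a b, 0 < (of fun i j : Fin p => V (a + i) (b + j)).det)
    (k : ℕ) (f g : Fin k → ℕ) (hf : StrictMono f) (hg : StrictMono g) :
    0 < (of fun i j : Fin k => V (f i) (g j)).det := by
  have h1 : ∀ p b (f : Fin p → ℕ), StrictMono f →
      0 < (of fun i j : Fin p => V (f i) (b + j)).det := fun p b f hf =>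
    det_pos_of_consecutive_rows p (fun i j => V i (b + j)) (fun p _ a => hV p a b) f hf
  -- The value `0` beyond `k` is never used, since only minors of order `p ≤ k` in the first `p`
  -- columns occur.
  set F : ℕ → ℕ := fun n => if h : n < k then f ⟨n, h⟩ else 0 with hF
  have h2 := det_pos_of_consecutive_rows k (fun i j => V (F j) i) (fun p hp a => by
    have h := h1 p a (fun i => f (Fin.castLE hp i)) (hf.comp (Fin.strictMono_castLE hp))
    rw [← det_transpose] at h
    convert h using 3
    ext i j
    have : (j : ℕ) < k := j.2.trans_le hp
    simp only [transpose_apply, of_apply, hF, this, dif_pos]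
    rfl) g hg
  rw [← det_transpose] at h2
  convert h2 using 3
  ext i j
  simp [hF]

/-! ### Hankel minors and passage to real nodes -/

/-- The Hankel matrices `(d (i + j + 1)) ^ (r d (i + j + 1))` are strictly totally positive. -/
theorem hankel_det_pos {r d : ℝ} (hr : 0 < r) (hd : 0 < d) (k : ℕ) (f g : Fin k → ℕ)
    (hf : StrictMono f) (hg : StrictMono g) :
    0 < (of fun i j : Fin k => Real.exp (r * ((d * (f i + g j + 1))
      * Real.log (d * (f i + g j + 1))))).det := by
  have h := det_pos_of_consecutive (fun a b => Real.exp (r * ((d * (a + b + 1))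
    * Real.log (d * (a + b + 1))))) (fun p a b => ?_) k f g hf hg
  · exact h
  -- Sharing the offset `a + b + 1` equally between rows and columns makes the minor symmetric, with
  -- a single family of nodes.
  · have h := (posDef_exp_mul_log (fun i : Fin p => d * ((a + b + 1) / 2 + i))
      (fun i => by positivity) (fun i j hij => ?_) hr).det_pos
    · refine h.trans_eq (congrArg det ?_)
      ext i j
      have : d * (((a + i : ℕ) : ℝ) + ((b + j : ℕ) : ℝ) + 1)
          = d * ((a + b + 1) / 2 + i) + d * ((a + b + 1) / 2 + j) := by push_cast; ring
      simp only [of_apply, this]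
    · have := mul_left_cancel₀ hd.ne' hij
      exact Fin.ext (by exact_mod_cast add_left_cancel this)

/-- Replace `x i` and `y j` by `⌊x i * N⌋₊ / N` and `⌊y j * N⌋₊ / N`: up to a shift `1 / N`, this
gives a Hankel minor with `d = 1 / N`. Strict positivity weakens to nonnegativity in the limit. -/
theorem det_exp_mul_log_nonneg {k : ℕ} (x y : Fin k → ℝ) (hx : ∀ i, 0 < x i) (hy : ∀ i, 0 < y i)
    (hxm : StrictMono x) (hym : StrictMono y) {r : ℝ} (hr : 0 < r) :
    0 ≤ (of fun i j : Fin k =>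
      Real.exp (r * ((x i + y j) * Real.log (x i + y j)))).det := by
  have hfloor : ∀ z : ℝ, 0 < z →
      Tendsto (fun N : ℕ => (N : ℝ)⁻¹ * (⌊z * N⌋₊ : ℝ)) atTop (𝓝 z) := fun z hz => by
    refine ((tendsto_nat_floor_mul_div_atTop hz.le).comp tendsto_natCast_atTop_atTop).congr ?_
    intro N
    simp [div_eq_inv_mul]
  have hmono : ∀ z : Fin k → ℝ, (∀ i, 0 < z i) → StrictMono z →
      ∀ᶠ N : ℕ in atTop, StrictMono fun i => ⌊z i * N⌋₊ := fun z hz hzm => by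
    have : ∀ᶠ N : ℕ in atTop, ∀ i j, i < j → ⌊z i * N⌋₊ < ⌊z j * N⌋₊ := by
      refine eventually_all.2 fun i => eventually_all.2 fun j => ?_
      by_cases hij : i < j
      · filter_upwards [(hfloor _ (hz i)).eventually_lt (hfloor _ (hz j)) (hzm hij)] with N hN _
        exact_mod_cast lt_of_mul_lt_mul_left hN (by positivity)
      · simp [hij]
    exact this.mono fun N hN i j hij => hN i j hij
  have hlim : Tendsto (fun N : ℕ => (of fun i j : Fin k =>
      Real.exp (r * (((N : ℝ)⁻¹ * (⌊x i * N⌋₊ + ⌊y j * N⌋₊ + 1))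
      * Real.log ((N : ℝ)⁻¹ * (⌊x i * N⌋₊ + ⌊y j * N⌋₊ + 1))))).det) atTop
      (𝓝 (of fun i j : Fin k => Real.exp (r * ((x i + y j) * Real.log (x i + y j)))).det) := by
    refine ((Continuous.matrix_det continuous_id).tendsto _).comp ?_
    refine tendsto_pi_nhds.2 fun i => tendsto_pi_nhds.2 fun j => ?_
    have h : Tendsto (fun N : ℕ => (N : ℝ)⁻¹ * (⌊x i * N⌋₊ + ⌊y j * N⌋₊ + 1)) atTop
        (𝓝 (x i + y j)) := by
      have := ((hfloor _ (hx i)).add (hfloor _ (hy j))).add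
        (tendsto_inv_atTop_nhds_zero_nat (𝕜 := ℝ))
      rw [add_zero] at this
      exact this.congr fun N => by ring
    exact (Real.continuous_exp.tendsto _).comp
      ((h.mul (h.log (add_pos (hx i) (hy j)).ne')).const_mul r)
  refine ge_of_tendsto hlim ?_
  filter_upwards [hmono x hx hxm, hmono y hy hym, eventually_gt_atTop 0] with N h1 h2 hN
  exact (hankel_det_pos hr (by positivity) k _ _ h1 h2).le

/-! ### The matrices `A` and `B` -/

theorem rpow_self_rpow {s : ℝ} (hs : 0 < s) (r : ℝ) :
    (s ^ s) ^ r = Real.exp (r * (s * Real.log s)) := by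
  rw [Real.rpow_def_of_pos hs, ← Real.exp_mul]; ring_nf

theorem hadamardPower_matrixB {n : ℕ} {p : Fin n → ℝ} (hp : ∀ i, 0 < p i) (r : ℝ) :
    hadamardPower (matrixB p) r
      = of fun i j => Real.exp (r * ((p i + p j) * Real.log (p i + p j))) := by
  ext i j
  exact rpow_self_rpow (add_pos (hp i) (hp j)) r

theorem hadamardPower_one {m n : ℕ} (M : Matrix (Fin m) (Fin n) ℝ) : hadamardPower M 1 = M := by
  ext i j
  exact Real.rpow_one _

theorem hadamardPower_matrixA (n : ℕ) (r : ℝ) :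
    hadamardPower (matrixA n) r = of fun i j : Fin n => Real.exp (r *
      ((1 * ((i : ℕ) + (j : ℕ) + 1 : ℝ)) * Real.log (1 * ((i : ℕ) + (j : ℕ) + 1 : ℝ)))) := by
  ext i j
  rw [of_apply, ← rpow_self_rpow (by positivity) r]
  simp only [hadamardPower, matrixA, of_apply, ← Real.rpow_natCast]
  push_cast
  rw [one_mul]

theorem isStrictlyTotallyPositive_hadamardPower_matrixA (n : ℕ) {r : ℝ} (hr : 0 < r) :
    IsStrictlyTotallyPositive (hadamardPower (matrixA n) r) := by
  intro k f g hf hg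
  rw [hadamardPower_matrixA]
  exact hankel_det_pos hr one_pos k (fun i => f i) (fun i => g i)
    (fun _ _ h => hf h) (fun _ _ h => hg h)

theorem mainTheorem1 :
    (∀ (n : ℕ) (p : Fin n → ℝ), (∀ i, 0 < p i) → StrictMono p →
      IsInfinitelyDivisible (matrixB p) ∧ IsUnit (matrixB p) ∧ IsTotallyPositive (matrixB p)) ∧
    (∀ n : ℕ, IsStrictlyTotallyPositive (matrixA n) ∧
      ∀ r : ℝ, 0 < r → IsStrictlyTotallyPositive (hadamardPower (matrixA n) r)) := by
  refine ⟨fun n p hp hpm => ⟨⟨fun i j => ?_, fun r hr => ?_⟩, ?_, fun k f g hf hg => ?_⟩,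
    fun n => ⟨?_, fun r hr => isStrictlyTotallyPositive_hadamardPower_matrixA n hr⟩⟩
  · exact Real.rpow_nonneg (add_pos (hp i) (hp j)).le _
  · rw [hadamardPower_matrixB hp]
    exact posSemidef_exp_mul_log p hp hr
  · rw [← hadamardPower_one (matrixB p), hadamardPower_matrixB hp]
    exact (posDef_exp_mul_log p hp hpm.injective one_pos).isUnit
  · rw [← hadamardPower_one (matrixB p), hadamardPower_matrixB hp]
    exact det_exp_mul_log_nonneg (fun i => p (f i)) (fun i => p (g i)) (fun _ => hp _)
      (fun _ => hp _) (hpm.comp hf) (hpm.comp hg) one_pos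
  · rw [← hadamardPower_one (matrixA n)]
    exact isStrictlyTotallyPositive_hadamardPower_matrixA n one_pos
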